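/- Let $\mathbb{D}=\{z\in\mathbb{C}: |z|<1\}$ and let $f:\mathbb{D}\to\mathbb{D}$ be holomorphic, with iterates $f^n$. Suppose that $f$ is parabolic with Wolff point $\tau_f\in\partial\mathbb{D}$; that is, $f$ has no fixed point in $\mathbb{D}$, $f^n\to\tau_f$ uniformly on compact subsets of $\mathbb{D}$, and $f'$ has non-tangential limit $1$ at $\tau_f$. Suppose also that $f$ has positive hyperbolic step; that is, there is $z_0\in\mathbb{D}$ with $$\lim_{n\to+\infty}\omega\bigl(f^n(z_0),f^{n+1}(z_0)\bigr)>0,$$ where $\omega(z_1,z_2)=\tanh^{-1}\left|\frac{z_2-z_1}{1-\overline{z_1}z_2}\right|$ is the Poincaré distance of $\mathbb{D}$. Then every orbit of $f$ converges to $\tau_f$ tangentially: for every $z\in\mathbb{D}$, $f^n(z)\to\tau_f$ and for every $M>1$ the points $f^n(z)$ lie outside the Stolz region $\{w\in\mathbb{D}: |\tau_f-w|<M(1-|w|)\}$ for all sufficiently large $n$. More precisely, there is a sign $\varepsilon\in\{1,-1\}$ such that for every $z\in\mathbb{D}$ $$\lim_{n\to+\infty}\frac{f^n(z)-\tau_f}{|f^n(z)-\tau_f|}=\varepsilon\,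 i\,\tau_f .$$ The sign $\varepsilon$ does not depend on $z$. -/

import Mathlib

open Filter Topology

namespace ParabolicDynamics

/-- The open unit disk of the complex plane. -/
def unitDisk : Set ℂ := Metric.ball (0 : ℂ) 1

/-- `f` restricts to a holomorphic self-map of the unit disk. The values of `f` outside the disk
are irrelevant, since all iterates of points of the disk stay in the disk. -/
def IsHolSelfMap (f : ℂ → ℂ) : Prop :=
  DifferentiableOn ℂ f unitDisk ∧ Set.MapsTo f unitDisk unitDisk

/-- The Poincaré distance `tanh⁻¹ |(z₂ - z₁) / (1 - conj z₁ * z₂)|` of the unit disk, where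
`tanh⁻¹ t = (1/2) log ((1 + t) / (1 - t))`. -/
noncomputable def poincareDist (z₁ z₂ : ℂ) : ℝ :=
  (1 / 2) * Real.log
    ((1 + ‖(z₂ - z₁) / (1 - (starRingEnd ℂ) z₁ * z₂)‖) /
      (1 - ‖(z₂ - z₁) / (1 - (starRingEnd ℂ) z₁ * z₂)‖))

/-- The hyperbolic step of `f` at `z` is `s`: the Poincaré distances between consecutive points of
the orbit of `z` converge to `s`. -/
def HasHyperbolicStepAt (f : ℂ → ℂ) (z : ℂ) (s : ℝ) : Prop :=
  Tendsto (fun n : ℕ => poincareDist (f^[n] z) (f^[n + 1] z)) atTop (𝓝 s)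

/-- `f` has positive hyperbolic step: its hyperbolic step is positive at some point of the disk. -/
def HasPositiveHyperbolicStep (f : ℂ → ℂ) : Prop :=
  ∃ z₀ ∈ unitDisk, ∃ s : ℝ, 0 < s ∧ HasHyperbolicStepAt f z₀ s

/-- The Stolz region of amplitude `M` with vertex at the boundary point `τ` (empty if `M ≤ 1`). -/
def stolzRegion (τ : ℂ) (M : ℝ) : Set ℂ :=
  {z | z ∈ unitDisk ∧ ‖τ - z‖ < M * (1 - ‖z‖)}

/-- `g` has non-tangential limit `L` at the boundary point `τ`: it tends to `L` at `τ` inside each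
Stolz region with vertex `τ`. -/
def HasNontangentialLimit (g : ℂ → ℂ) (τ L : ℂ) : Prop :=
  ∀ M : ℝ, Tendsto g (𝓝[stolzRegion τ M] τ) (𝓝 L)

/-- `τ` is the Wolff point of `f`: a point of the unit circle to which the iterates of `f`
converge uniformly on compact subsets of the disk. -/
def IsWolffPoint (f : ℂ → ℂ) (τ : ℂ) : Prop :=
  ‖τ‖ = 1 ∧ ∀ K : Set ℂ, K ⊆ unitDisk → IsCompact K →
    TendstoUniformlyOn (fun (n : ℕ) (z : ℂ) => f^[n] z) (fun _ => τ) atTop K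

/-- `f` is a parabolic self-map of the disk with Wolff point `τ`: it is holomorphic, has no fixed
point in the disk, and its derivative has non-tangential limit `1` at its Wolff point `τ`. -/
def IsParabolicWithWolffPoint (f : ℂ → ℂ) (τ : ℂ) : Prop :=
  IsHolSelfMap f ∧ (∀ z ∈ unitDisk, f z ≠ z) ∧ IsWolffPoint f τ ∧
    HasNontangentialLimit (deriv f) τ 1

/-- The sequence `u` of points of the disk converges to the boundary point `τ` tangentially: it
converges to `τ` and eventually leaves every Stolz region with vertex `τ`. -/
def ConvergesTangentially (u : ℕ → ℂ) (τ : ℂ) : Prop :=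
  Tendsto u atTop (𝓝 τ) ∧ ∀ M : ℝ, ∀ᶠ n in atTop, u n ∉ stolzRegion τ M

end ParabolicDynamics

namespace ParabolicDynamics

open Complex ComplexConjugate

/-! Along the orbit z_n of z₀, tangency is the statement (1 - |z_n|)/|z_n - τ| → 0. If z_n kept
returning to a Stolz region, `f - id`, which has small derivative there, would give |f(z_n) - z_n| ≤
η|z_n - τ| ≤ ηM(1 - |z_n|), contradicting the positive step (`eventually_notMem_stolzRegion`). By
Schwarz–Pick any other orbit stays within O(1 - |z_n|) = o(|z_n - τ|) of z_n, so it inherits both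
tangency and limiting direction. Tangency forces the directions towards ±iτ. Comparing the orbit
with its own shift makes consecutive directions asymptotically equal, so the sign is eventually
constant (`exists_tendsto_direction`). -/

lemma mem_unitDisk {z : ℂ} : z ∈ unitDisk ↔ ‖z‖ < 1 := by
  simp [unitDisk]

/-! ### Schwarz–Pick and pseudohyperbolic disks -/

lemma norm_conj_mul_lt_one {a z : ℂ} (ha : ‖a‖ < 1) (hz : ‖z‖ < 1) : ‖conj a * z‖ < 1 := by
  rw [norm_mul, Complex.norm_conj]
  nlinarith [norm_nonneg a, norm_nonneg z]

lemma one_sub_conj_mul_ne_zero {a z : ℂ} (ha : ‖a‖ < 1) (hz : ‖z‖ < 1) :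
    1 - conj a * z ≠ 0 := by
  intro h
  have := norm_conj_mul_lt_one ha hz
  rw [← sub_eq_zero.mp h] at this
  simp at this

/-- The Möbius automorphism of the disk that sends `a` to `0`. -/
noncomputable def diskMobius (a z : ℂ) : ℂ := (z - a) / (1 - conj a * z)

lemma norm_diskMobius_lt_one {a z : ℂ} (ha : ‖a‖ < 1) (hz : ‖z‖ < 1) :
    ‖diskMobius a z‖ < 1 := by
  have h0 := one_sub_conj_mul_ne_zero ha hz
  rw [diskMobius, norm_div, div_lt_one (norm_pos_iff.mpr h0)]
  refine lt_of_pow_lt_pow_left₀ 2 (norm_nonneg _) ?_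
  have e : ‖1 - conj a * z‖ ^ 2 - ‖z - a‖ ^ 2 = (1 - ‖a‖ ^ 2) * (1 - ‖z‖ ^ 2) := by
    simp only [Complex.sq_norm, Complex.normSq_apply, Complex.sub_re, Complex.sub_im,
      Complex.mul_re, Complex.mul_im, Complex.conj_re, Complex.conj_im, Complex.one_re,
      Complex.one_im]
    ring
  have h1 : 0 < 1 - ‖a‖ ^ 2 := by nlinarith [norm_nonneg a]
  have h2 : 0 < 1 - ‖z‖ ^ 2 := by nlinarith [norm_nonneg z]
  nlinarith [mul_pos h1 h2]

lemma diskMobius_neg_diskMobius {a z : ℂ} (ha : ‖a‖ < 1) (hz : ‖z‖ < 1) :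
    diskMobius (-a) (diskMobius a z) = z := by
  have h0 := one_sub_conj_mul_ne_zero ha hz
  have h1 := one_sub_conj_mul_ne_zero ha ha
  have e1 : diskMobius a z - -a = z * (1 - conj a * a) / (1 - conj a * z) := by
    rw [diskMobius, eq_div_iff h0, sub_neg_eq_add, add_mul, div_mul_cancel₀ _ h0]
    ring
  have e2 : 1 - conj (-a) * diskMobius a z = (1 - conj a * a) / (1 - conj a * z) := by
    rw [diskMobius, map_neg, eq_div_iff h0, sub_mul, mul_assoc, div_mul_cancel₀ _ h0]
    ring
  rw [diskMobius, e1, e2, div_div_div_cancel_right₀ h0, mul_div_cancel_right₀ _ h1]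

lemma differentiableOn_diskMobius {a : ℂ} (ha : ‖a‖ < 1) :
    DifferentiableOn ℂ (diskMobius a) unitDisk := by
  unfold diskMobius
  refine DifferentiableOn.div (by fun_prop) (by fun_prop) fun z hz => ?_
  exact one_sub_conj_mul_ne_zero ha (mem_unitDisk.mp hz)

lemma mapsTo_diskMobius {a : ℂ} (ha : ‖a‖ < 1) :
    Set.MapsTo (diskMobius a) unitDisk unitDisk := fun _ hz =>
  mem_unitDisk.mpr (norm_diskMobius_lt_one ha (mem_unitDisk.mp hz))

/-- The **Schwarz–Pick lemma**. -/
theorem IsHolSelfMap.norm_diskMobius_le {h : ℂ → ℂ} (hh : IsHolSelfMap h) {a z : ℂ}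
    (ha : a ∈ unitDisk) (hz : z ∈ unitDisk) :
    ‖diskMobius (h a) (h z)‖ ≤ ‖diskMobius a z‖ := by
  have ha' := mem_unitDisk.mp ha
  have hz' := mem_unitDisk.mp hz
  have hna : ‖-a‖ < 1 := by rwa [norm_neg]
  have hha := mem_unitDisk.mp (hh.2 ha)
  have hm : Set.MapsTo (fun w => diskMobius (h a) (h (diskMobius (-a) w))) unitDisk unitDisk :=
    fun w hw => mapsTo_diskMobius hha (hh.2 (mapsTo_diskMobius hna hw))
  have hd : DifferentiableOn ℂ (fun w => diskMobius (h a) (h (diskMobius (-a) w))) unitDisk :=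
    (differentiableOn_diskMobius hha).comp (hh.1.comp (differentiableOn_diskMobius hna)
      (mapsTo_diskMobius hna)) fun w hw => hh.2 (mapsTo_diskMobius hna hw)
  have := Complex.norm_le_norm_of_mapsTo_ball (z := diskMobius a z) hd
    (hm.mono_right Metric.ball_subset_closedBall) (by simp [diskMobius])
    (norm_diskMobius_lt_one ha' hz')
  simpa only [diskMobius_neg_diskMobius ha' hz'] using this

lemma IsHolSelfMap.iterate {f : ℂ → ℂ} (hf : IsHolSelfMap f) (n : ℕ) : IsHolSelfMap f^[n] := by
  induction n with
  | zero => exact ⟨differentiableOn_id, Set.mapsTo_id _⟩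
  | succ n ih =>
    rw [Function.iterate_succ]
    exact ⟨ih.1.comp hf.1 hf.2, ih.2.comp hf.2⟩

/-- A pseudohyperbolic disk around `z` has Euclidean size comparable to `1 - ‖z‖`. -/
lemma norm_sub_le_of_norm_diskMobius_le {z w : ℂ} {r : ℝ} (hz : ‖z‖ < 1) (hw : ‖w‖ < 1)
    (hr : r < 1) (h : ‖diskMobius z w‖ ≤ r) : ‖w - z‖ ≤ 2 / (1 - r) * (1 - ‖z‖) := by
  have h0 := norm_pos_iff.mpr (one_sub_conj_mul_ne_zero hz hw)
  have hr0 : 0 ≤ r := (norm_nonneg _).trans h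
  rw [diskMobius, norm_div, div_le_iff₀ h0] at h
  -- Expanding the denominator around `z` leaves a term r‖w - z‖ to absorb on the left, whence 1/(1
  -- - r); the 2 comes from 1 + ‖z‖ ≤ 2.
  have e : 1 - conj z * w = ((1 - ‖z‖ ^ 2 : ℝ) : ℂ) - conj z * (w - z) := by
    have : conj z * z = ((‖z‖ ^ 2 : ℝ) : ℂ) := by
      rw [mul_comm, Complex.mul_conj, Complex.normSq_eq_norm_sq]
    push_cast at this ⊢
    linear_combination -this
  have h1 : ‖1 - conj z * w‖ ≤ (1 - ‖z‖ ^ 2) + ‖w - z‖ := by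
    rw [e]
    refine (norm_sub_le _ _).trans (add_le_add ?_ ?_)
    · rw [Complex.norm_real, Real.norm_of_nonneg]
      nlinarith [norm_nonneg z]
    · rw [norm_mul, Complex.norm_conj]
      nlinarith [norm_nonneg (w - z)]
  rw [div_mul_eq_mul_div, le_div_iff₀ (by linarith)]
  nlinarith [norm_nonneg z, norm_nonneg (w - z), mul_nonneg (sub_nonneg.mpr hz.le) hr0,
    mul_le_mul_of_nonneg_left h1 hr0]

/-- Two orbits stay at bounded hyperbolic distance from each other. -/
lemma IsHolSelfMap.exists_norm_iterate_sub_le {f : ℂ → ℂ} (hf : IsHolSelfMap f) {z w : ℂ}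
    (hz : z ∈ unitDisk) (hw : w ∈ unitDisk) :
    ∃ C : ℝ, 0 ≤ C ∧ ∀ n : ℕ, ‖f^[n] w - f^[n] z‖ ≤ C * (1 - ‖f^[n] z‖) := by
  have hr := norm_diskMobius_lt_one (mem_unitDisk.mp hz) (mem_unitDisk.mp hw)
  refine ⟨2 / (1 - ‖diskMobius z w‖), div_nonneg zero_le_two (by linarith), fun n => ?_⟩
  have hn := hf.iterate n
  exact norm_sub_le_of_norm_diskMobius_le (mem_unitDisk.mp (hn.2 hz)) (mem_unitDisk.mp (hn.2 hw))
    hr (hn.norm_diskMobius_le hz hw)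

/-! ### Stolz regions and the positive step -/

/-- Convexity is what lets the mean value inequality be applied inside the region. -/
lemma convex_stolzRegion (τ : ℂ) {M : ℝ} (hM : 0 ≤ M) : Convex ℝ (stolzRegion τ M) := by
  intro z hz w hw a b ha hb hab
  have hn : ‖a • z + b • w‖ ≤ a * ‖z‖ + b * ‖w‖ := by
    refine (norm_add_le _ _).trans_eq ?_
    rw [norm_smul, norm_smul, Real.norm_of_nonneg ha, Real.norm_of_nonneg hb]
  have ht : ‖τ - (a • z + b • w)‖ ≤ a * ‖τ - z‖ + b * ‖τ - w‖ := by
    have : τ - (a • z + b • w) = a • (τ - z) + b • (τ - w) := by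
      have : τ = a • τ + b • τ := by rw [← add_smul, hab, one_smul]
      nth_rewrite 1 [this]
      module
    rw [this]
    refine (norm_add_le _ _).trans_eq ?_
    rw [norm_smul, norm_smul, Real.norm_of_nonneg ha, Real.norm_of_nonneg hb]
  refine ⟨convex_ball (0 : ℂ) 1 hz.1 hw.1 ha hb hab, ht.trans_lt ?_⟩
  have h1 : a * ‖τ - z‖ + b * ‖τ - w‖ < a * (M * (1 - ‖z‖)) + b * (M * (1 - ‖w‖)) := by
    rcases ha.eq_or_lt with rfl | ha
    · have : b = 1 := by linarith
      subst this
      simpa using hw.2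
    · exact add_lt_add_of_lt_of_le (mul_lt_mul_of_pos_left hz.2 ha)
        (mul_le_mul_of_nonneg_left hw.2.le hb)
  refine h1.trans_le ?_
  have : a * (M * (1 - ‖z‖)) + b * (M * (1 - ‖w‖)) = M * ((a + b) - (a * ‖z‖ + b * ‖w‖)) := by
    ring
  rw [this, hab]
  exact mul_le_mul_of_nonneg_left (by linarith) hM

/-- If `f'` has non-tangential limit `1` at `τ`, then `f - id` is Lipschitz with an arbitrarily
small constant on a truncated Stolz region. -/
lemma exists_forall_norm_sub_sub_le {f : ℂ → ℂ} {τ : ℂ} (hf : IsHolSelfMap f)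
    (hd : HasNontangentialLimit (deriv f) τ 1) {M ε : ℝ} (hM : 0 ≤ M) (hε : 0 < ε) :
    ∃ δ > 0, ∀ z ∈ stolzRegion τ M ∩ Metric.ball τ δ, ∀ w ∈ stolzRegion τ M ∩ Metric.ball τ δ,
      ‖(f z - z) - (f w - w)‖ ≤ ε * ‖z - w‖ := by
  obtain ⟨δ, hδ, h⟩ := Metric.tendsto_nhdsWithin_nhds.mp (hd M) ε hε
  refine ⟨δ, hδ, fun z hz w hw => ?_⟩
  have hfd : ∀ x ∈ stolzRegion τ M ∩ Metric.ball τ δ, DifferentiableAt ℂ f x := fun x hx =>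
    hf.1.differentiableAt (Metric.isOpen_ball.mem_nhds hx.1.1)
  refine Convex.norm_image_sub_le_of_norm_deriv_le (𝕜 := ℂ) (f := fun x => f x - x)
    (fun x hx => (hfd x hx).sub differentiableAt_id) (fun x hx => ?_)
    ((convex_stolzRegion τ hM).inter (convex_ball τ δ)) hw hz
  rw [deriv_fun_sub (hfd x hx) differentiableAt_fun_id, deriv_id'']
  have := h hx.1 hx.2
  rw [dist_eq_norm] at this
  exact this.le

/-- An orbit of positive hyperbolic step eventually leaves each Stolz region. -/
lemma eventually_notMem_stolzRegion {f : ℂ → ℂ} {τ z : ℂ} {s : ℝ} (hf : IsHolSelfMap f)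
    (hd : HasNontangentialLimit (deriv f) τ 1)
    (hlim : Tendsto (fun n : ℕ => f^[n] z) atTop (𝓝 τ)) (hs : 0 < s)
    (hstep : HasHyperbolicStepAt f z s) {M : ℝ} (hM : 0 < M) :
    ∀ᶠ n in atTop, f^[n] z ∉ stolzRegion τ M := by
  by_contra hcon
  have hfreq : ∃ᶠ n in atTop, f^[n] z ∈ stolzRegion τ M := by
    rwa [Filter.not_eventually, Filter.frequently_congr (.of_forall fun _ => not_not)] at hcon
  have hcont : ContinuousAt (fun t : ℝ => 1 / 2 * Real.log ((1 + t) / (1 - t))) 0 := by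
    fun_prop (disch := norm_num)
  have hc0 : ∀ᶠ t in 𝓝 (0 : ℝ), 1 / 2 * Real.log ((1 + t) / (1 - t)) < s / 2 :=
    hcont.eventually_lt_const (by simpa using hs)
  obtain ⟨ε, hε, hsmall⟩ := Metric.eventually_nhds_iff.mp hc0
  -- The factor M will cancel the Stolz constant, and the 2 leaves room for a strict inequality.
  obtain ⟨δ, hδ, hlip⟩ := exists_forall_norm_sub_sub_le hf hd hM.le (ε := ε / (2 * M))
    (by positivity)
  have hball : ∀ᶠ n in atTop, f^[n] z ∈ Metric.ball τ δ :=
    hlim.eventually (Metric.ball_mem_nhds τ hδ)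
  have hfreq' : ∃ᶠ n in atTop, f^[n] z ∈ stolzRegion τ M ∩ Metric.ball τ δ :=
    hfreq.and_eventually hball
  have hlim1 : Tendsto (fun n : ℕ => f (f^[n] z)) atTop (𝓝 τ) := by
    refine (hlim.comp (tendsto_add_atTop_nat 1)).congr fun n => ?_
    exact Function.iterate_succ_apply' f n z
  have hbig : ∀ᶠ n in atTop, s / 2 < poincareDist (f^[n] z) (f^[n + 1] z) :=
    hstep.eventually_const_lt (by linarith)
  obtain ⟨n, hn, hsn⟩ := (hfreq'.and_eventually hbig).exists
  -- Fix `n` and let the second point run to τ through later visits to the region; the displacement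
  -- there tends to 0. Infinitely many visits suffice.
  have key : ‖f (f^[n] z) - f^[n] z‖ ≤ ε / (2 * M) * ‖f^[n] z - τ‖ := by
    have hl : Tendsto (fun m : ℕ => ‖(f (f^[n] z) - f^[n] z) - (f (f^[m] z) - f^[m] z)‖) atTop
        (𝓝 ‖f (f^[n] z) - f^[n] z‖) := by
      simpa using (tendsto_const_nhds.sub (hlim1.sub hlim)).norm
    have hr : Tendsto (fun m : ℕ => ε / (2 * M) * ‖f^[n] z - f^[m] z‖) atTop
        (𝓝 (ε / (2 * M) * ‖f^[n] z - τ‖)) :=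
      (tendsto_const_nhds.sub hlim).norm.const_mul _
    have := ge_of_tendsto_of_frequently (hr.sub hl)
      (hfreq'.mono fun m hm => sub_nonneg.mpr (hlip _ hn _ hm))
    linarith
  have hzn := mem_unitDisk.mp hn.1.1
  have hzn1 := mem_unitDisk.mp (hf.2 hn.1.1)
  have hden : 1 - ‖f^[n] z‖ ≤ ‖1 - conj (f^[n] z) * f (f^[n] z)‖ := by
    refine le_trans ?_ (norm_sub_norm_le _ _)
    rw [norm_one, norm_mul, Complex.norm_conj]
    nlinarith [norm_nonneg (f^[n] z)]
  have hle : ‖(f (f^[n] z) - f^[n] z) / (1 - conj (f^[n] z) * f (f^[n] z))‖ < ε := by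
    have h2 := hn.1.2
    rw [norm_sub_rev] at h2
    rw [norm_div, div_lt_iff₀ (by linarith)]
    calc ‖f (f^[n] z) - f^[n] z‖ ≤ ε / (2 * M) * ‖f^[n] z - τ‖ := key
      _ ≤ ε / (2 * M) * (M * (1 - ‖f^[n] z‖)) := by gcongr
      _ = ε / 2 * (1 - ‖f^[n] z‖) := by field_simp
      _ < ε * (1 - ‖f^[n] z‖) := by
        apply mul_lt_mul_of_pos_right <;> linarith
      _ ≤ _ := by gcongr
  have := hsmall (y := ‖(f (f^[n] z) - f^[n] z) / (1 - conj (f^[n] z) * f (f^[n] z))‖)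
    (by simpa [dist_eq_norm] using hle)
  rw [poincareDist, Function.iterate_succ_apply'] at hsn
  exact absurd hsn this.not_gt

/-! ### Tangency as a ratio, and directions -/

lemma tendsto_one_sub_norm_div {u : ℕ → ℂ} {τ : ℂ} (hτ : ‖τ‖ = 1) (hu : ∀ n, u n ∈ unitDisk)
    (h : ∀ M : ℝ, 0 < M → ∀ᶠ n in atTop, u n ∉ stolzRegion τ M) :
    Tendsto (fun n => (1 - ‖u n‖) / ‖u n - τ‖) atTop (𝓝 0) := by
  rw [Metric.tendsto_nhds]
  intro c hc
  filter_upwards [h (2 / c) (by positivity)] with n hn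
  have hn1 := mem_unitDisk.mp (hu n)
  have hpos : 0 < ‖u n - τ‖ := by
    rw [norm_pos_iff, sub_ne_zero]
    rintro e
    rw [e, hτ] at hn1
    exact lt_irrefl _ hn1
  have hn2 : 2 / c * (1 - ‖u n‖) ≤ ‖u n - τ‖ := by
    rw [norm_sub_rev]
    exact not_lt.mp fun hlt => hn ⟨hu n, hlt⟩
  rw [Real.dist_eq, sub_zero, abs_of_nonneg (div_nonneg (by linarith) hpos.le),
    div_lt_iff₀ hpos]
  rw [div_mul_eq_mul_div, div_le_iff₀ hc] at hn2
  nlinarith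

lemma ConvergesTangentially.of_tendsto_div {u : ℕ → ℂ} {τ : ℂ} (hτ : ‖τ‖ = 1)
    (hlim : Tendsto u atTop (𝓝 τ))
    (h : Tendsto (fun n => (1 - ‖u n‖) / ‖u n - τ‖) atTop (𝓝 0)) :
    ConvergesTangentially u τ := by
  refine ⟨hlim, fun M => ?_⟩
  filter_upwards [(h.const_mul M).eventually_lt_const (u := 1) (by simp)] with n hn hmem
  have hn1 := mem_unitDisk.mp hmem.1
  have hpos : 0 < ‖u n - τ‖ := by
    rw [norm_pos_iff, sub_ne_zero]
    rintro e
    rw [e, hτ] at hn1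
    exact lt_irrefl _ hn1
  rw [← mul_div_assoc, div_lt_one hpos, norm_sub_rev] at hn
  exact lt_asymm hn hmem.2

lemma norm_div_norm_sub_div_norm_le {a b : ℂ} (ha : a ≠ 0) (hb : b ≠ 0) :
    ‖a / (‖a‖ : ℂ) - b / (‖b‖ : ℂ)‖ ≤ 2 * (‖b - a‖ / ‖a‖) := by
  have ha' : 0 < ‖a‖ := norm_pos_iff.mpr ha
  have hb' : 0 < ‖b‖ := norm_pos_iff.mpr hb
  have hac : (‖a‖ : ℂ) ≠ 0 := by exact_mod_cast ha'.ne'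
  have hbc : (‖b‖ : ℂ) ≠ 0 := by exact_mod_cast hb'.ne'
  have e : a / (‖a‖ : ℂ) - b / (‖b‖ : ℂ)
      = ((a - b) + b / (‖b‖ : ℂ) * ((‖b‖ - ‖a‖ : ℝ) : ℂ)) / (‖a‖ : ℂ) := by
    push_cast
    field_simp
    ring
  rw [e, norm_div, Complex.norm_real, norm_norm, ← mul_div_assoc]
  gcongr
  refine (norm_add_le _ _).trans ?_
  rw [norm_mul, norm_div, Complex.norm_real, Complex.norm_real, norm_norm, div_self hb'.ne',
    one_mul, norm_sub_rev, two_mul, Real.norm_eq_abs]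
  gcongr
  exact abs_norm_sub_norm_le b a

lemma sub_ne_zero_of_mem_unitDisk {z τ : ℂ} (hτ : ‖τ‖ = 1) (hz : z ∈ unitDisk) : z - τ ≠ 0 := by
  rw [sub_ne_zero]
  rintro rfl
  exact (mem_unitDisk.mp hz).ne hτ

/-- The real part of the normalized direction of a sequence converging tangentially to `τ` tends
to zero. -/
lemma tendsto_re_direction {u : ℕ → ℂ} {τ : ℂ} (hτ : ‖τ‖ = 1) (hu : ∀ n, u n ∈ unitDisk)
    (hlim : Tendsto u atTop (𝓝 τ))
    (h : Tendsto (fun n => (1 - ‖u n‖) / ‖u n - τ‖) atTop (𝓝 0)) :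
    Tendsto (fun n => (conj τ * ((u n - τ) / (‖u n - τ‖ : ℂ))).re) atTop (𝓝 0) := by
  have hdist : Tendsto (fun n => ‖u n - τ‖) atTop (𝓝 0) := by
    simpa using (hlim.sub_const τ).norm
  have hb : Tendsto (fun n => ‖u n - τ‖ / 2 + (1 - ‖u n‖) / ‖u n - τ‖) atTop (𝓝 0) := by
    simpa using (hdist.div_const 2).add h
  refine squeeze_zero_norm (fun n => ?_) hb
  have hn1 := mem_unitDisk.mp (hu n)
  have hpos := norm_pos_iff.mpr (sub_ne_zero_of_mem_unitDisk hτ (hu n))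
  -- Expand ‖u‖² = ‖τ + (u - τ)‖² with ‖τ‖ = 1.
  have e : (conj τ * (u n - τ)).re = -((‖u n - τ‖ ^ 2 + (1 - ‖u n‖ ^ 2)) / 2) := by
    have h1 : τ.re * τ.re + τ.im * τ.im = 1 := by
      rw [← Complex.normSq_apply, Complex.normSq_eq_norm_sq, hτ, one_pow]
    simp only [Complex.sq_norm, Complex.normSq_apply, Complex.sub_re, Complex.sub_im,
      Complex.mul_re, Complex.conj_re, Complex.conj_im]
    linear_combination (-1 / 2) * h1
  rw [← mul_div_assoc, Complex.div_ofReal_re, e, norm_div, norm_neg, norm_norm,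
    Real.norm_of_nonneg (by nlinarith [norm_nonneg (u n), sq_nonneg ‖u n - τ‖]),
    div_le_iff₀ hpos, add_mul, div_mul_cancel₀ _ hpos.ne']
  nlinarith [norm_nonneg (u n)]

/-- A real sequence with vanishing increments whose squares tend to `1` converges. -/
lemma exists_tendsto_of_sq_tendsto_one {s : ℕ → ℝ} (h1 : Tendsto (fun n => s n ^ 2) atTop (𝓝 1))
    (h2 : Tendsto (fun n => s (n + 1) - s n) atTop (𝓝 0)) :
    ∃ ε : ℝ, (ε = 1 ∨ ε = -1) ∧ Tendsto s atTop (𝓝 ε) := by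
  have habs : Tendsto (fun n => |s n|) atTop (𝓝 1) := by
    simpa [Real.sqrt_sq_eq_abs] using h1.sqrt
  -- Beyond `N` a sign change would need a jump larger than 1/2 + 1/2.
  obtain ⟨N, hN⟩ := eventually_atTop.mp ((habs.eventually_const_lt (u := 1 / 2) (by norm_num)).and
    (h2.norm.eventually_lt_const (u := 1) (by simp)))
  rcases le_or_gt 0 (s N) with h0 | h0
  · have hpos : ∀ n ≥ N, 0 ≤ s n := by
      intro n hn
      induction n, hn using Nat.le_induction with
      | base => exact h0
      | succ n hn ih =>
        obtain ⟨ha, hb⟩ := hN n hn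
        have hc := (hN (n + 1) (by omega)).1
        rw [Real.norm_eq_abs, abs_lt] at hb
        rw [abs_of_nonneg ih] at ha
        by_contra hneg
        rw [abs_of_neg (not_le.mp hneg)] at hc
        linarith
    refine ⟨1, .inl rfl, habs.congr' ?_⟩
    filter_upwards [eventually_ge_atTop N] with n hn
    exact abs_of_nonneg (hpos n hn)
  · have hneg : ∀ n ≥ N, s n < 0 := by
      intro n hn
      induction n, hn using Nat.le_induction with
      | base => exact h0
      | succ n hn ih =>
        obtain ⟨ha, hb⟩ := hN n hn
        have hc := (hN (n + 1) (by omega)).1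
        rw [Real.norm_eq_abs, abs_lt] at hb
        rw [abs_of_neg ih] at ha
        by_contra hpos
        rw [abs_of_nonneg (not_lt.mp hpos)] at hc
        linarith
    refine ⟨-1, .inr rfl, habs.neg.congr' ?_⟩
    filter_upwards [eventually_ge_atTop N] with n hn
    rw [abs_of_neg (hneg n hn), neg_neg]

/-! ### Transfer between sequences at distance O(1 - ‖u‖) -/

section Comparison

variable {u v : ℕ → ℂ} {τ : ℂ} {C : ℝ}

lemma tendsto_norm_sub_div (hC : ∀ n, ‖v n - u n‖ ≤ C * (1 - ‖u n‖))
    (h : Tendsto (fun n => (1 - ‖u n‖) / ‖u n - τ‖) atTop (𝓝 0)) :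
    Tendsto (fun n => ‖v n - u n‖ / ‖u n - τ‖) atTop (𝓝 0) := by
  have h' : Tendsto (fun n => C * ((1 - ‖u n‖) / ‖u n - τ‖)) atTop (𝓝 0) := by
    simpa using h.const_mul C
  refine squeeze_zero (fun n => by positivity) (fun n => ?_) h'
  rw [← mul_div_assoc]
  exact div_le_div_of_nonneg_right (hC n) (norm_nonneg _)

lemma tendsto_direction_sub (hτ : ‖τ‖ = 1) (hu : ∀ n, u n ∈ unitDisk) (hv : ∀ n, v n ∈ unitDisk)
    (hC : ∀ n, ‖v n - u n‖ ≤ C * (1 - ‖u n‖))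
    (h : Tendsto (fun n => (1 - ‖u n‖) / ‖u n - τ‖) atTop (𝓝 0)) :
    Tendsto (fun n => (v n - τ) / (‖v n - τ‖ : ℂ) - (u n - τ) / (‖u n - τ‖ : ℂ)) atTop (𝓝 0) := by
  have h' : Tendsto (fun n => 2 * (‖v n - u n‖ / ‖u n - τ‖)) atTop (𝓝 0) := by
    simpa using (tendsto_norm_sub_div hC h).const_mul 2
  refine squeeze_zero_norm (fun n => ?_) h'
  have := norm_div_norm_sub_div_norm_le (sub_ne_zero_of_mem_unitDisk hτ (hu n))
    (sub_ne_zero_of_mem_unitDisk hτ (hv n))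
  rwa [sub_sub_sub_cancel_right, norm_sub_rev] at this

lemma tendsto_one_sub_norm_div_of_comparable (hτ : ‖τ‖ = 1) (hu : ∀ n, u n ∈ unitDisk)
    (hv : ∀ n, v n ∈ unitDisk) (hC0 : 0 ≤ C) (hC : ∀ n, ‖v n - u n‖ ≤ C * (1 - ‖u n‖))
    (h : Tendsto (fun n => (1 - ‖u n‖) / ‖u n - τ‖) atTop (𝓝 0)) :
    Tendsto (fun n => (1 - ‖v n‖) / ‖v n - τ‖) atTop (𝓝 0) := by
  have h' : Tendsto (fun n => 2 * (1 + C) * ((1 - ‖u n‖) / ‖u n - τ‖)) atTop (𝓝 0) := by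
    simpa using h.const_mul (2 * (1 + C))
  refine squeeze_zero' (.of_forall fun n => ?_) ?_ h'
  · exact div_nonneg (sub_nonneg.mpr (mem_unitDisk.mp (hv n)).le) (norm_nonneg _)
  filter_upwards [(tendsto_norm_sub_div hC h).eventually_lt_const (u := 1 / 2) (by norm_num)]
    with n hn
  have hun := mem_unitDisk.mp (hu n)
  have hpu := norm_pos_iff.mpr (sub_ne_zero_of_mem_unitDisk hτ (hu n))
  have hpv := norm_pos_iff.mpr (sub_ne_zero_of_mem_unitDisk hτ (hv n))
  rw [div_lt_iff₀ hpu] at hn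
  have h1 : ‖u n - τ‖ / 2 ≤ ‖v n - τ‖ := by
    have := norm_sub_norm_le (u n - τ) (v n - τ)
    rw [sub_sub_sub_cancel_right, norm_sub_rev (u n) (v n)] at this
    linarith
  have h2 : 1 - ‖v n‖ ≤ (1 + C) * (1 - ‖u n‖) := by
    have := norm_sub_norm_le (u n) (v n)
    rw [norm_sub_rev (u n) (v n)] at this
    linarith [hC n]
  calc (1 - ‖v n‖) / ‖v n - τ‖ ≤ ((1 + C) * (1 - ‖u n‖)) / (‖u n - τ‖ / 2) := by
        apply div_le_div₀ _ h2 (by positivity) h1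
        exact mul_nonneg (by linarith) (by linarith)
    _ = _ := by field_simp

end Comparison

/-- The directions of a tangentially convergent sequence with asymptotically constant direction
converge to one of the two tangent directions. -/
lemma exists_tendsto_direction {u : ℕ → ℂ} {τ : ℂ} (hτ : ‖τ‖ = 1) (hu : ∀ n, u n ∈ unitDisk)
    (hlim : Tendsto u atTop (𝓝 τ))
    (h : Tendsto (fun n => (1 - ‖u n‖) / ‖u n - τ‖) atTop (𝓝 0))
    (hd : Tendsto (fun n => (u (n + 1) - τ) / (‖u (n + 1) - τ‖ : ℂ)
      - (u n - τ) / (‖u n - τ‖ : ℂ)) atTop (𝓝 0)) :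
    ∃ ε : ℂ, (ε = 1 ∨ ε = -1) ∧
      Tendsto (fun n => (u n - τ) / (‖u n - τ‖ : ℂ)) atTop (𝓝 (ε * Complex.I * τ)) := by
  set d : ℕ → ℂ := fun n => conj τ * ((u n - τ) / (‖u n - τ‖ : ℂ)) with hd_def
  have hre : Tendsto (fun n => (d n).re) atTop (𝓝 0) := tendsto_re_direction hτ hu hlim h
  have hnorm : ∀ n, ‖d n‖ = 1 := fun n => by
    have hpos := norm_pos_iff.mpr (sub_ne_zero_of_mem_unitDisk hτ (hu n))
    rw [hd_def]
    simp only [norm_mul, norm_div, Complex.norm_conj, hτ, Complex.norm_real, norm_norm, one_mul]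
    exact div_self hpos.ne'
  have him2 : Tendsto (fun n => (d n).im ^ 2) atTop (𝓝 1) := by
    have h1 : Tendsto (fun n => 1 - (d n).re ^ 2) atTop (𝓝 1) := by
      simpa using (hre.pow 2).const_sub 1
    refine h1.congr fun n => ?_
    have := Complex.sq_norm (d n)
    rw [hnorm, Complex.normSq_apply] at this
    linarith
  have hdiff : Tendsto (fun n => (d (n + 1)).im - (d n).im) atTop (𝓝 0) := by
    have h1 : Tendsto (fun n => d (n + 1) - d n) atTop (𝓝 0) := by
      have := hd.const_mul (conj τ)
      rw [mul_zero] at this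
      exact this.congr fun n => mul_sub _ _ _
    simpa [Function.comp_def] using (Complex.continuous_im.tendsto 0).comp h1
  obtain ⟨ε, hε, him⟩ := exists_tendsto_of_sq_tendsto_one him2 hdiff
  refine ⟨(ε : ℂ), by rcases hε with rfl | rfl <;> simp, ?_⟩
  have hdlim : Tendsto d atTop (𝓝 ((ε : ℂ) * Complex.I)) := by
    have h1 := ((Complex.continuous_ofReal.tendsto _).comp hre).add
      (((Complex.continuous_ofReal.tendsto _).comp him).mul_const Complex.I)
    rw [Complex.ofReal_zero, zero_add] at h1
    exact h1.congr fun n => Complex.re_add_im (d n)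
  refine (hdlim.mul_const τ).congr fun n => ?_
  have hττ : conj τ * τ = 1 := by
    rw [mul_comm, Complex.mul_conj, Complex.normSq_eq_norm_sq, hτ]
    simp
  rw [hd_def]
  linear_combination ((u n - τ) / (‖u n - τ‖ : ℂ)) * hττ

lemma IsWolffPoint.tendsto_iterate {f : ℂ → ℂ} {τ z : ℂ} (h : IsWolffPoint f τ)
    (hz : z ∈ unitDisk) : Tendsto (fun n : ℕ => f^[n] z) atTop (𝓝 τ) :=
  (h.2 {z} (Set.singleton_subset_iff.mpr hz) isCompact_singleton).tendsto_at
    (Set.mem_singleton z)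

end ParabolicDynamics

open ParabolicDynamics in
theorem mainTheorem6 (f : ℂ → ℂ) (τ : ℂ)
    (hf : ParabolicDynamics.IsParabolicWithWolffPoint f τ)
    (hstep : ParabolicDynamics.HasPositiveHyperbolicStep f) :
    (∀ z ∈ ParabolicDynamics.unitDisk,
      ParabolicDynamics.ConvergesTangentially (fun n : ℕ => f^[n] z) τ) ∧
    ∃ ε : ℂ, (ε = 1 ∨ ε = -1) ∧
      ∀ z ∈ ParabolicDynamics.unitDisk,
        Tendsto (fun n : ℕ => (f^[n] z - τ) / ((‖f^[n] z - τ‖ : ℝ) : ℂ)) atTop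
          (𝓝 (ε * Complex.I * τ)) := by
  obtain ⟨hh, -, hW, hd⟩ := hf
  obtain ⟨z₀, hz₀, s, hs, hs₀⟩ := hstep
  have hτ := hW.1
  have horb : ∀ z ∈ unitDisk, ∀ n : ℕ, f^[n] z ∈ unitDisk := fun z hz n => (hh.iterate n).2 hz
  have h₀ : Tendsto (fun n : ℕ => (1 - ‖f^[n] z₀‖) / ‖f^[n] z₀ - τ‖) atTop (𝓝 0) :=
    tendsto_one_sub_norm_div hτ (horb z₀ hz₀) fun M hM =>
      eventually_notMem_stolzRegion hh hd (hW.tendsto_iterate hz₀) hs hs₀ hM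
  refine ⟨fun z hz => ?_, ?_⟩
  · obtain ⟨C, hC0, hC⟩ := hh.exists_norm_iterate_sub_le hz₀ hz
    exact .of_tendsto_div hτ (hW.tendsto_iterate hz) (tendsto_one_sub_norm_div_of_comparable hτ
      (horb z₀ hz₀) (horb z hz) hC0 hC h₀)
  -- The orbit of `f z₀` is the shifted orbit of `z₀`, so comparing the two controls consecutive
  -- directions.
  · obtain ⟨C, -, hC⟩ := hh.exists_norm_iterate_sub_le hz₀ (hh.2 hz₀)
    obtain ⟨ε, hε, hlim⟩ := exists_tendsto_direction hτ (horb z₀ hz₀) (hW.tendsto_iterate hz₀) h₀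
      (tendsto_direction_sub hτ (horb z₀ hz₀) (horb _ (hh.2 hz₀)) hC h₀)
    refine ⟨ε, hε, fun z hz => ?_⟩
    obtain ⟨C', -, hC'⟩ := hh.exists_norm_iterate_sub_le hz₀ hz
    have := (tendsto_direction_sub hτ (horb z₀ hz₀) (horb z hz) hC' h₀).add hlim
    simpa using this
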